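/- Let $n,m,p\in\mathbb N$, let $A:\mathbb R^p\to\mathbb R^{n\times n}$ and $B:\mathbb R^p\to\mathbb R^{n\times m}$ be affine, and let $Q\in\mathbb R^{n\times n}$, $R\in\mathbb R^{m\times m}$ be symmetric positive definite. Let $\Theta\subset\mathbb R^p$ be compact and convex, and suppose that for every $\theta\in\Theta$ the pair $(A(\theta),B(\theta))$ is stabilizable, i.e. there is a matrix $K$ such that all eigenvalues of $A(\theta)+B(\theta)K$ have modulus less than $1$. Let $\bar W\ge 0$. Then for every $\theta\in\Theta$ the discrete-time algebraic Riccati equation $$P=A(\theta)^\top PA(\theta)-A(\theta)^\top PB(\theta)\bigl(R+B(\theta)^\top PB(\theta)\bigr)^{-1}B(\theta)^\top PA(\theta)+Q$$ has a unique positive definite solution $P=P(\theta)$. Put $K_{\mathrm{LQR}}(\theta)=-(R+B(\theta)^\top P(\theta)B(\theta))^{-1}B(\theta)^\top P(\theta)A(\theta)$ and $V(x,\theta)=x^\top P(\theta)x$, and let $\|\cdot\|$ be the Euclidean norm. Moreover, there exist constants $\alpha,\nu_2,\nu_3,\nu_4>0$, depending only on $A,B,Q,R,\Theta,\bar W$,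 such that for all $X\in\mathbb R$ and $\mu>0$ there are constants $\beta,\gamma>0$ with $$\beta=\nu_2\mu X^2+\nu_3\mu+\nu_4$$ for which the following holds. Let $(x_k)$, $(u_k)$, $(w_k)$, $(\theta_k)$, $(\hat\theta_k)$, $k\in\mathbb N=\{0,1,2,\dots\}$, be any sequences in $\mathbb R^n,\mathbb R^m,\mathbb R^n,\mathbb R^p,\mathbb R^p$, respectively, with $$x_{k+1}=A(\theta_k)x_k+B(\theta_k)u_k+w_k,\qquad u_k=K_{\mathrm{LQR}}(\hat\theta_k)x_k,$$ $\|w_k\|\le\bar W$, $\theta_k\in\Theta$, $\hat\theta_k\in\Theta$ and $\|x_k\|\le X$ for all $k\in\mathbb N$, and let $e_{1|k}=x_{k+1}-A(\hat\theta_k)x_k-B(\hat\theta_k)u_k-w_k$. If $$\|\hat\theta_{k+1}-\hat\theta_k\|\le\sqrt\mu\,\|e_{1|k}+w_k\|\quad\text{for all }k\in\mathbb N,$$ then $$V(x_{k+1},\hat\theta_{k+1})-V(x_k,\hat\theta_k)\le-\alpha\|x_k\|^2+\beta\|e_{1|k}\|^2+\gamma\|w_k\|^2\quad\text{for all }k\in\mathbb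 N.$$ -/

import Mathlib

open Matrix

noncomputable section

namespace AdaptiveLQR

/-- A real square matrix is Schur stable if all its complex eigenvalues lie in the open unit disc. -/
def IsSchur {n : ℕ} (M : Matrix (Fin n) (Fin n) ℝ) : Prop :=
  ∀ z ∈ spectrum ℂ (M.map (algebraMap ℝ ℂ)), ‖z‖ < 1

/-- The pair `(A, B)` is stabilizable if some static state feedback `u = K x` makes the
closed-loop matrix `A + B K` Schur stable. -/
def IsStabilizable {n m : ℕ} (A : Matrix (Fin n) (Fin n) ℝ) (B : Matrix (Fin n) (Fin m) ℝ) :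
    Prop :=
  ∃ K : Matrix (Fin m) (Fin n) ℝ, IsSchur (A + B * K)

/-- `P` is a positive definite solution of the discrete-time algebraic Riccati equation. -/
def IsRiccatiSolution {n m : ℕ} (A : Matrix (Fin n) (Fin n) ℝ) (B : Matrix (Fin n) (Fin m) ℝ)
    (Q : Matrix (Fin n) (Fin n) ℝ) (R : Matrix (Fin m) (Fin m) ℝ)
    (P : Matrix (Fin n) (Fin n) ℝ) : Prop :=
  P.PosDef ∧
    P = Aᵀ * P * A - Aᵀ * P * B * (R + Bᵀ * P * B)⁻¹ * Bᵀ * P * A + Q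

open Classical in
/-- The positive definite solution of the discrete-time algebraic Riccati equation
(with value `0` if there is none). -/
def riccatiP {n m : ℕ} (A : Matrix (Fin n) (Fin n) ℝ) (B : Matrix (Fin n) (Fin m) ℝ)
    (Q : Matrix (Fin n) (Fin n) ℝ) (R : Matrix (Fin m) (Fin m) ℝ) :
    Matrix (Fin n) (Fin n) ℝ :=
  if h : ∃ P, IsRiccatiSolution A B Q R P then h.choose else 0

/-- The LQR gain `K = -(R + Bᵀ P B)⁻¹ Bᵀ P A`, where `P` solves the Riccati equation. -/
def lqrGain {n m : ℕ} (A : Matrix (Fin n) (Fin n) ℝ) (B : Matrix (Fin n) (Fin m) ℝ)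
    (Q : Matrix (Fin n) (Fin n) ℝ) (R : Matrix (Fin m) (Fin m) ℝ) :
    Matrix (Fin m) (Fin n) ℝ :=
  -((R + Bᵀ * riccatiP A B Q R * B)⁻¹ * Bᵀ * riccatiP A B Q R * A)

/-- The product of a matrix with a vector, between Euclidean spaces. -/
def mulE {a b : ℕ} (M : Matrix (Fin a) (Fin b) ℝ) (v : EuclideanSpace ℝ (Fin b)) :
    EuclideanSpace ℝ (Fin a) :=
  WithLp.toLp 2 (M *ᵥ v.ofLp)

/-- The function `V(x, θ) = xᵀ P(θ) x`. -/
def lyapunovV {n m p : ℕ}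
    (A : EuclideanSpace ℝ (Fin p) →ᵃ[ℝ] Matrix (Fin n) (Fin n) ℝ)
    (B : EuclideanSpace ℝ (Fin p) →ᵃ[ℝ] Matrix (Fin n) (Fin m) ℝ)
    (Q : Matrix (Fin n) (Fin n) ℝ) (R : Matrix (Fin m) (Fin m) ℝ)
    (x : EuclideanSpace ℝ (Fin n)) (θ : EuclideanSpace ℝ (Fin p)) : ℝ :=
  x.ofLp ⬝ᵥ (riccatiP (A θ) (B θ) Q R *ᵥ x.ofLp)

/-- The nominal prediction `A(θ) x + B(θ) u` of the next state. -/
def prediction {n m p : ℕ}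
    (A : EuclideanSpace ℝ (Fin p) →ᵃ[ℝ] Matrix (Fin n) (Fin n) ℝ)
    (B : EuclideanSpace ℝ (Fin p) →ᵃ[ℝ] Matrix (Fin n) (Fin m) ℝ)
    (θ : EuclideanSpace ℝ (Fin p)) (x : EuclideanSpace ℝ (Fin n))
    (u : EuclideanSpace ℝ (Fin m)) : EuclideanSpace ℝ (Fin n) :=
  mulE (A θ) x + mulE (B θ) u

/-- The 1-step nominal prediction error `x₊ - (A(θ̂) x + B(θ̂) u) - w`, where `xnext = x₊` is the
next state and `θhat = θ̂` the parameter estimate. -/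
def predError {n m p : ℕ}
    (A : EuclideanSpace ℝ (Fin p) →ᵃ[ℝ] Matrix (Fin n) (Fin n) ℝ)
    (B : EuclideanSpace ℝ (Fin p) →ᵃ[ℝ] Matrix (Fin n) (Fin m) ℝ)
    (θhat : EuclideanSpace ℝ (Fin p)) (x : EuclideanSpace ℝ (Fin n))
    (u : EuclideanSpace ℝ (Fin m)) (xnext w : EuclideanSpace ℝ (Fin n)) :
    EuclideanSpace ℝ (Fin n) :=
  xnext - prediction A B θhat x u - w

end AdaptiveLQR

end

/-!
Completing the square in the feedback `K` exhibits the Riccati map as the Loewner minimum over `K`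
of the affine maps `P ↦ (A + B K)ᵀ P (A + B K) + Q + Kᵀ R K`. Hence value iteration from `0`
increases, a stabilizing gain bounds it from above, and its limit solves the Riccati equation.
Moreover, every `S ≥ 0` lying above its own image under one of the affine maps lies above every
solution, because `Q > 0` makes the closed loop a strict contraction in the `S`-form; this gives
uniqueness.

The same comparison gives the dependence on the parameter: for `θ'` near `θ` the gain for `θ` still
works, and a small multiple of `Q` pays for the change of the closed loop, so that
`(1 + O(‖θ' - θ‖)) P(θ)` lies above `P(θ')`. With compactness, `P` is bounded and Lipschitz on `Θ`.
Along a trajectory the nominal decrease `-xᵀ (Q + Kᵀ R K) x` then absorbs, by Young's inequality,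
the cross terms with the disturbance `e + w` and the drift of the parameter, which is at most
`√μ ‖e + w‖`.
-/

noncomputable section

namespace AdaptiveLQR

open Filter Topology
open scoped MatrixOrder Matrix.Norms.L2Operator NNReal

section LoewnerOrder

variable {ι κ : Type*}

lemma isHermitian_of_nonneg {P : Matrix ι ι ℝ} (hP : 0 ≤ P) : P.IsHermitian :=
  (nonneg_iff_posSemidef.1 hP).isHermitian

instance instOrderClosedTopologyMatrix [Finite ι] :
    OrderClosedTopology (Matrix ι ι ℝ) where
  isClosed_le' := by
    have := Fintype.ofFinite ι
    simp only [Matrix.le_iff, posSemidef_iff_dotProduct_mulVec, IsHermitian, Set.ofPred_and,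
      Set.ofPred_forall]
    exact (isClosed_eq (by fun_prop) (by fun_prop)).inter
      (isClosed_iInter fun x => isClosed_le (by fun_prop) (by fun_prop))

lemma apply_eq_polarization [Fintype ι] [DecidableEq ι] {H : Matrix ι ι ℝ} (hH : H.IsHermitian)
    (i j : ι) :
    H i j = ((Pi.single i 1 + Pi.single j 1) ⬝ᵥ (H *ᵥ (Pi.single i 1 + Pi.single j 1))
      - Pi.single i 1 ⬝ᵥ (H *ᵥ Pi.single i 1) - Pi.single j 1 ⬝ᵥ (H *ᵥ Pi.single j 1)) / 2 := by
  have hji : H j i = H i j := congrFun (congrFun hH i) j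
  simp only [mulVec_add, mulVec_single_one, add_dotProduct, dotProduct_add,
    single_one_dotProduct, col_apply, hji]
  ring

lemma exists_pos_smul_one_le [Finite ι] [DecidableEq ι] {Q : Matrix ι ι ℝ} (hQ : Q.PosDef) :
    ∃ q : ℝ, 0 < q ∧ q • 1 ≤ Q := by
  have := Fintype.ofFinite ι
  cases isEmpty_or_nonempty ι
  · exact ⟨1, one_pos, (Subsingleton.elim _ _).le⟩
  · have hsa : IsSelfAdjoint Q := hQ.isHermitian
    simpa only [← Algebra.algebraMap_eq_smul_one] using
      (CFC.exists_pos_algebraMap_le_iff hsa).2 fun _ =>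
        (isStrictlyPositive_iff_posDef.2 hQ).spectrum_pos

lemma dotProduct_mulVec_mono [Fintype ι] {P S : Matrix ι ι ℝ} (h : P ≤ S) (x : ι → ℝ) :
    x ⬝ᵥ (P *ᵥ x) ≤ x ⬝ᵥ (S *ᵥ x) := by
  have := (Matrix.le_iff.1 h).dotProduct_mulVec_nonneg x
  rw [star_trivial, sub_mulVec, dotProduct_sub] at this
  exact sub_nonneg.1 this

lemma exists_tendsto_of_monotone_of_bddAbove [Finite ι] {p : ℕ → Matrix ι ι ℝ}
    (hp : Monotone p) (hbdd : BddAbove (Set.range p)) : ∃ P, Tendsto p atTop (𝓝 P) := by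
  classical
  have := Fintype.ofFinite ι
  obtain ⟨S, hS⟩ := hbdd
  have hform (x : ι → ℝ) : ∃ l, Tendsto (fun k => x ⬝ᵥ ((p k - p 0) *ᵥ x)) atTop (𝓝 l) :=
    ⟨_, tendsto_atTop_ciSup
      (fun _ _ hkl => dotProduct_mulVec_mono (sub_le_sub_right (hp hkl) _) x)
      ⟨x ⬝ᵥ ((S - p 0) *ᵥ x), Set.forall_mem_range.2 fun k =>
        dotProduct_mulVec_mono (sub_le_sub_right (hS ⟨k, rfl⟩) _) x⟩⟩
  choose l hl using hform
  have hsymm (k : ℕ) : (p k - p 0).IsHermitian :=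
    isHermitian_of_nonneg (sub_nonneg.2 (hp k.zero_le))
  have hentry (i j : ι) : ∃ c, Tendsto (fun k => (p k - p 0) i j) atTop (𝓝 c) := by
    simp only [fun k => apply_eq_polarization (hsymm k) i j]
    exact ⟨_, (((hl _).sub (hl _)).sub (hl _)).div_const 2⟩
  choose D hD using hentry
  have hdiff : Tendsto (fun k => p k - p 0) atTop (𝓝 (Matrix.of D)) :=
    tendsto_pi_nhds.2 fun i => tendsto_pi_nhds.2 fun j => hD i j
  exact ⟨_, by simpa using hdiff.add_const (p 0)⟩

variable [Fintype ι]

lemma transpose_mul_mul_mono [Finite κ] {P S : Matrix ι ι ℝ} (h : P ≤ S) (N : Matrix ι κ ℝ) :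
    Nᵀ * P * N ≤ Nᵀ * S * N := by
  have := (Matrix.le_iff.1 h).conjTranspose_mul_mul_same N
  rwa [conjTranspose_eq_transpose_of_trivial, Matrix.mul_sub, Matrix.sub_mul] at this

lemma transpose_mul_mul_nonneg [Finite κ] {P : Matrix ι ι ℝ} (hP : 0 ≤ P) (N : Matrix ι κ ℝ) :
    0 ≤ Nᵀ * P * N := by
  simpa using transpose_mul_mul_mono hP N

lemma nonpos_of_le_transpose_mul_mul {D S M : Matrix ι ι ℝ} {t ρ : ℝ} (ht : 0 ≤ t) (hρ : 0 ≤ ρ)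
    (hρ1 : ρ < 1) (hD : D ≤ Mᵀ * D * M) (hS : Mᵀ * S * M ≤ ρ • S) (hDS : D ≤ t • S) : D ≤ 0 := by
  have hgeom (k : ℕ) : D ≤ (t * ρ ^ k) • S := by
    induction k with
    | zero => simpa using hDS
    | succ k ih =>
      calc D ≤ Mᵀ * D * M := hD
        _ ≤ Mᵀ * ((t * ρ ^ k) • S) * M := transpose_mul_mul_mono ih M
        _ = (t * ρ ^ k) • (Mᵀ * S * M) := by simp
        _ ≤ (t * ρ ^ k) • (ρ • S) := by gcongr
        _ = (t * ρ ^ (k + 1)) • S := by rw [smul_smul, pow_succ, mul_assoc]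
  have hlim : Tendsto (fun k : ℕ => (t * ρ ^ k) • S) atTop (𝓝 ((t * 0) • S)) :=
    ((tendsto_pow_atTop_nhds_zero_of_lt_one hρ hρ1).const_mul t).smul_const S
  simpa using ge_of_tendsto' hlim hgeom

variable [DecidableEq ι]

lemma norm_le_iff_of_isHermitian {H : Matrix ι ι ℝ} (hH : H.IsHermitian) {c : ℝ} (hc : 0 ≤ c) :
    ‖H‖ ≤ c ↔ -(c • 1) ≤ H ∧ H ≤ c • 1 := by
  have hsa : IsSelfAdjoint H := hH
  conv_lhs => rw [← cfc_id ℝ H]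
  rw [norm_cfc_le_iff _ _ hc, ← Algebra.algebraMap_eq_smul_one, ← map_neg,
    algebraMap_le_iff_le_spectrum, le_algebraMap_iff_spectrum_le, ← forall₂_and]
  simp only [id_eq, Real.norm_eq_abs, abs_le]

lemma le_norm_smul_one {H : Matrix ι ι ℝ} (hH : H.IsHermitian) : H ≤ ‖H‖ • 1 :=
  ((norm_le_iff_of_isHermitian hH (norm_nonneg H)).1 le_rfl).2

lemma le_add_smul_one_of_norm_sub_le {P S : Matrix ι ι ℝ} (hP : P.IsHermitian)
    (hS : S.IsHermitian) {t : ℝ} (h : ‖S - P‖ ≤ t) : S ≤ P + t • 1 :=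
  sub_le_iff_le_add'.1 ((le_norm_smul_one (hS.sub hP)).trans
    (smul_le_smul_of_nonneg_right h PosSemidef.one.nonneg))

lemma le_smul_of_add_smul_one_le {S T : Matrix ι ι ℝ} {q : ℝ} (hq : 0 < q) (hS : 0 ≤ S)
    (h : T + q • 1 ≤ S) : T ≤ (‖S‖ / (q + ‖S‖)) • S := by
  have hSq : (q / (q + ‖S‖)) • S ≤ q • 1 := calc
    (q / (q + ‖S‖)) • S ≤ (q / (q + ‖S‖)) • (‖S‖ • 1) := by
      gcongr
      exact le_norm_smul_one (isHermitian_of_nonneg hS)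
    _ = (q * (‖S‖ / (q + ‖S‖))) • 1 := by rw [smul_smul]; ring_nf
    _ ≤ q • 1 := smul_le_smul_of_nonneg_right
      (mul_le_of_le_one_right hq.le (div_le_one_of_le₀ (by linarith) (by positivity)))
      PosSemidef.one.nonneg
  have hsplit : (‖S‖ / (q + ‖S‖)) • S + (q / (q + ‖S‖)) • S = S := by
    rw [← add_smul, ← add_div, add_comm ‖S‖, div_self (by positivity), one_smul]
  refine le_of_add_le_add_right (a := q • 1) ?_
  calc T + q • 1 ≤ (‖S‖ / (q + ‖S‖)) • S + (q / (q + ‖S‖)) • S := h.trans_eq hsplit.symm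
    _ ≤ (‖S‖ / (q + ‖S‖)) • S + q • 1 := by gcongr

lemma transpose_mul_mul_le_add_smul_one {P : Matrix ι ι ℝ} (hP : P.IsHermitian)
    (M M' : Matrix ι ι ℝ) :
    M'ᵀ * P * M' ≤ Mᵀ * P * M + (‖P‖ * ‖M' - M‖ * (‖M‖ + ‖M'‖)) • 1 := by
  have hfactor : M'ᵀ * P * M' - Mᵀ * P * M = (M' - M)ᵀ * P * M' + Mᵀ * P * (M' - M) := by
    simp [Matrix.mul_sub, Matrix.sub_mul]
  have htranspose (N : Matrix ι ι ℝ) : ‖Nᵀ‖ = ‖N‖ := by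
    rw [← conjTranspose_eq_transpose_of_trivial, l2_opNorm_conjTranspose]
  refine le_add_smul_one_of_norm_sub_le (isHermitian_conjTranspose_mul_mul M hP)
    (isHermitian_conjTranspose_mul_mul M' hP) ?_
  calc ‖M'ᵀ * P * M' - Mᵀ * P * M‖
      ≤ ‖(M' - M)ᵀ‖ * ‖P‖ * ‖M'‖ + ‖Mᵀ‖ * ‖P‖ * ‖M' - M‖ := by
        rw [hfactor]
        exact norm_add_le_of_le (norm_mul₃_le ..) (norm_mul₃_le ..)
    _ = ‖P‖ * ‖M' - M‖ * (‖M‖ + ‖M'‖) := by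
        rw [htranspose, htranspose]
        ring

lemma norm_le_of_le_smul_one {P : Matrix ι ι ℝ} (hP : 0 ≤ P) {c : ℝ} (hc : 0 ≤ c)
    (h : P ≤ c • 1) : ‖P‖ ≤ c :=
  (norm_le_iff_of_isHermitian (isHermitian_of_nonneg hP) hc).2
    ⟨(neg_nonpos.2 (smul_nonneg hc PosSemidef.one.nonneg)).trans hP, h⟩

lemma mul_sq_norm_le_of_transpose_mul_mul_le [Fintype κ] [DecidableEq κ] {S : Matrix ι ι ℝ}
    {N : Matrix ι κ ℝ} {c m : ℝ} (hc : 0 ≤ c) (hm : 0 ≤ m) (hS : c • 1 ≤ S)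
    (hN : Nᵀ * S * N ≤ m • 1) : c * ‖N‖ ^ 2 ≤ m := by
  have h : c • (Nᵀ * N) ≤ m • 1 := by
    simpa using (transpose_mul_mul_mono hS N).trans hN
  have h0 : 0 ≤ c • (Nᵀ * N) := by
    simpa using smul_nonneg hc (transpose_mul_mul_nonneg PosSemidef.one.nonneg N)
  calc c * ‖N‖ ^ 2 = ‖c • (Nᵀ * N)‖ := by
        rw [norm_smul, Real.norm_of_nonneg hc, sq, ← l2_opNorm_conjTranspose_mul_self,
          conjTranspose_eq_transpose_of_trivial]
    _ ≤ m := norm_le_of_le_smul_one h0 hm h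

end LoewnerOrder

section Riccati

variable {ι κ : Type*} [Fintype ι]

lemma posDef_add_transpose_mul_mul [Finite κ] {R : Matrix κ κ ℝ} {P : Matrix ι ι ℝ}
    (hR : R.PosDef) (hP : 0 ≤ P) (B : Matrix ι κ ℝ) : (R + Bᵀ * P * B).PosDef :=
  hR.add_posSemidef (nonneg_iff_posSemidef.1 (transpose_mul_mul_nonneg hP B))

variable [Fintype κ]

/-- One step of policy evaluation: if the cost-to-go is `xᵀ P x` and the feedback `u = K x` is used
now, then the cost, with running cost `xᵀ Q x + uᵀ R u`, is given by this matrix. -/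
def policyMap (A : Matrix ι ι ℝ) (B : Matrix ι κ ℝ) (Q : Matrix ι ι ℝ) (R : Matrix κ κ ℝ)
    (K : Matrix κ ι ℝ) (P : Matrix ι ι ℝ) : Matrix ι ι ℝ :=
  (A + B * K)ᵀ * P * (A + B * K) + (Q + Kᵀ * R * K)

variable {A : Matrix ι ι ℝ} {B : Matrix ι κ ℝ} {Q : Matrix ι ι ℝ} {R : Matrix κ κ ℝ}
  {P S : Matrix ι ι ℝ}

lemma policyMap_mono (h : P ≤ S) (K : Matrix κ ι ℝ) :
    policyMap A B Q R K P ≤ policyMap A B Q R K S :=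
  add_le_add_left (transpose_mul_mul_mono h _) _

lemma le_policyMap (hR : R.PosDef) (hP : 0 ≤ P) (K : Matrix κ ι ℝ) :
    Q ≤ policyMap A B Q R K P :=
  (le_add_of_nonneg_right (transpose_mul_mul_nonneg hR.posSemidef.nonneg K)).trans
    (le_add_of_nonneg_left (transpose_mul_mul_nonneg hP _))

variable [DecidableEq κ]

/-- The right-hand side of the Riccati equation, i.e. one step of value iteration. The bracketing is
that of `IsRiccatiSolution`. -/
def riccatiMap (A : Matrix ι ι ℝ) (B : Matrix ι κ ℝ) (Q : Matrix ι ι ℝ) (R : Matrix κ κ ℝ)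
    (P : Matrix ι ι ℝ) : Matrix ι ι ℝ :=
  Aᵀ * P * A - Aᵀ * P * B * (R + Bᵀ * P * B)⁻¹ * Bᵀ * P * A + Q

/-- The gain `K` minimising `policyMap A B Q R K P`; it does not depend on `Q`. The bracketing is
that of `lqrGain`. -/
def greedyGain (A : Matrix ι ι ℝ) (B : Matrix ι κ ℝ) (R : Matrix κ κ ℝ) (P : Matrix ι ι ℝ) :
    Matrix κ ι ℝ :=
  -((R + Bᵀ * P * B)⁻¹ * Bᵀ * P * A)

lemma mul_greedyGain (hR : R.PosDef) (hP : 0 ≤ P) :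
    (R + Bᵀ * P * B) * greedyGain A B R P = -(Bᵀ * P * A) := by
  have hdet := (isUnit_iff_isUnit_det _).1 (posDef_add_transpose_mul_mul hR hP B).isUnit
  simp only [greedyGain, Matrix.mul_neg, Matrix.mul_assoc]
  rw [← Matrix.mul_assoc, mul_nonsing_inv _ (by simpa only [Matrix.mul_assoc] using hdet),
    Matrix.one_mul]

lemma policyMap_eq_riccatiMap_add (hR : R.PosDef) (hP : 0 ≤ P) (K : Matrix κ ι ℝ) :
    policyMap A B Q R K P = riccatiMap A B Q R P +
      (K - greedyGain A B R P)ᵀ * (R + Bᵀ * P * B) * (K - greedyGain A B R P) := by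
  set g := greedyGain A B R P
  have hg : (R + Bᵀ * P * B) * g = -(Bᵀ * P * A) := mul_greedyGain hR hP
  have hPT : Pᵀ = P := isHermitian_of_nonneg hP
  have hgT : gᵀ * (R + Bᵀ * P * B) = -(Aᵀ * P * B) := by
    have hG : (R + Bᵀ * P * B)ᵀ = R + Bᵀ * P * B :=
      (posDef_add_transpose_mul_mul hR hP B).isHermitian
    rw [← transpose_inj, transpose_mul, hG, transpose_transpose, hg]
    simp [hPT, Matrix.mul_assoc]
  have hric : riccatiMap A B Q R P = Aᵀ * P * A + Aᵀ * P * B * g + Q := by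
    simp [riccatiMap, g, greedyGain, Matrix.mul_assoc, sub_eq_add_neg]
  calc policyMap A B Q R K P
      = Aᵀ * P * A + Q + Kᵀ * (Bᵀ * P * A) + Aᵀ * P * B * K + Kᵀ * (R + Bᵀ * P * B) * K := by
        simp only [policyMap, transpose_add, transpose_mul, Matrix.mul_add, Matrix.add_mul,
          Matrix.mul_assoc]
        abel
    _ = riccatiMap A B Q R P + (Kᵀ * (R + Bᵀ * P * B) * K - Kᵀ * ((R + Bᵀ * P * B) * g)
          - (gᵀ * (R + Bᵀ * P * B) * K - gᵀ * (R + Bᵀ * P * B) * g)) := by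
        rw [hg, hgT, hric]
        simp only [Matrix.mul_neg, Matrix.neg_mul]
        abel
    _ = _ := by
        simp only [transpose_sub, Matrix.mul_sub, Matrix.sub_mul, Matrix.mul_assoc]
        abel

lemma riccatiMap_le_policyMap (hR : R.PosDef) (hP : 0 ≤ P) (K : Matrix κ ι ℝ) :
    riccatiMap A B Q R P ≤ policyMap A B Q R K P := by
  rw [policyMap_eq_riccatiMap_add hR hP K]
  exact le_add_of_nonneg_right
    (transpose_mul_mul_nonneg (posDef_add_transpose_mul_mul hR hP B).posSemidef.nonneg _)

lemma policyMap_greedyGain (hR : R.PosDef) (hP : 0 ≤ P) :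
    policyMap A B Q R (greedyGain A B R P) P = riccatiMap A B Q R P := by
  simp [policyMap_eq_riccatiMap_add hR hP]

lemma riccatiMap_mono (hR : R.PosDef) (hP : 0 ≤ P) (h : P ≤ S) :
    riccatiMap A B Q R P ≤ riccatiMap A B Q R S :=
  calc riccatiMap A B Q R P ≤ policyMap A B Q R (greedyGain A B R S) P :=
        riccatiMap_le_policyMap hR hP _
    _ ≤ policyMap A B Q R (greedyGain A B R S) S := policyMap_mono h _
    _ = riccatiMap A B Q R S := policyMap_greedyGain hR (hP.trans h)

lemma le_riccatiMap (hR : R.PosDef) (hP : 0 ≤ P) : Q ≤ riccatiMap A B Q R P :=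
  (le_policyMap hR hP _).trans_eq (policyMap_greedyGain hR hP)

lemma le_of_le_riccatiMap_of_policyMap_le (hQ : Q.PosDef) (hR : R.PosDef) {K : Matrix κ ι ℝ}
    (hP : 0 ≤ P) (hPsub : P ≤ riccatiMap A B Q R P) (hS : 0 ≤ S)
    (hSsuper : policyMap A B Q R K S ≤ S) : P ≤ S := by
  classical
  obtain ⟨q, hq, hqQ⟩ := exists_pos_smul_one_le hQ
  have hQS : Q ≤ S := (le_policyMap hR hS K).trans hSsuper
  have hcontract : (A + B * K)ᵀ * S * (A + B * K) ≤ (‖S‖ / (q + ‖S‖)) • S :=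
    le_smul_of_add_smul_one_le hq hS <| calc
      (A + B * K)ᵀ * S * (A + B * K) + q • 1 ≤ policyMap A B Q R K S :=
        add_le_add_right (hqQ.trans
          (le_add_of_nonneg_right (transpose_mul_mul_nonneg hR.posSemidef.nonneg K))) _
      _ ≤ S := hSsuper
  have hdiff : P - S ≤ (A + B * K)ᵀ * (P - S) * (A + B * K) := calc
    P - S ≤ policyMap A B Q R K P - policyMap A B Q R K S :=
      sub_le_sub (hPsub.trans (riccatiMap_le_policyMap hR hP K)) hSsuper
    _ = (A + B * K)ᵀ * (P - S) * (A + B * K) := by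
      simp [policyMap, Matrix.mul_sub, Matrix.sub_mul]
  have hbound : P - S ≤ (‖P‖ / q) • S := calc
    P - S ≤ P := sub_le_self _ hS
    _ ≤ ‖P‖ • 1 := le_norm_smul_one (isHermitian_of_nonneg hP)
    _ = (‖P‖ / q) • (q • 1) := by rw [smul_smul, div_mul_cancel₀ _ hq.ne']
    _ ≤ (‖P‖ / q) • S := by gcongr; exact hqQ.trans hQS
  have hρ1 : ‖S‖ / (q + ‖S‖) < 1 := (div_lt_one (by positivity)).2 (by linarith)
  exact sub_nonpos.1 (nonpos_of_le_transpose_mul_mul (by positivity) (by positivity) hρ1 hdiff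
    hcontract hbound)

end Riccati

section Schur

lemma summable_norm_pow_of_spectralRadius_lt_one {E : Type*} [NormedRing E] [NormedAlgebra ℂ E]
    [CompleteSpace E] {a : E} (h : spectralRadius ℂ a < 1) : Summable fun k : ℕ => ‖a ^ k‖ := by
  obtain ⟨r, hr, hr1⟩ := ENNReal.lt_iff_exists_nnreal_btwn.1 h
  refine Summable.of_norm_bounded_eventually_nat
    (summable_geometric_of_lt_one r.2 (by exact_mod_cast hr1)) ?_
  have hroot := spectrum.pow_nnnorm_pow_one_div_tendsto_nhds_spectralRadius a
  filter_upwards [hroot.eventually_lt_const hr, eventually_gt_atTop 0] with k hk hk0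
  have hpow : ((‖a ^ k‖₊ : ENNReal) ^ (1 / k : ℝ)) ^ (k : ℝ) ≤ (r : ENNReal) ^ (k : ℝ) :=
    ENNReal.rpow_le_rpow hk.le (by positivity)
  rw [← ENNReal.rpow_mul, one_div_mul_cancel (by positivity), ENNReal.rpow_one,
    ENNReal.rpow_natCast] at hpow
  rw [norm_norm]
  exact_mod_cast hpow

variable {ι : Type*} [Fintype ι] [DecidableEq ι]

lemma summable_norm_pow_of_spectralRadius_map_lt_one {M : Matrix ι ι ℝ}
    (hM : spectralRadius ℂ (M.map (algebraMap ℝ ℂ)) < 1) : Summable fun k : ℕ => ‖M ^ k‖ := by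
  let rePart : Matrix ι ι ℂ →L[ℝ] Matrix ι ι ℝ := Complex.reLm.mapMatrix.toContinuousLinearMap
  have hre (k : ℕ) : rePart (M.map (algebraMap ℝ ℂ) ^ k) = M ^ k := by
    have hmap : (M ^ k).map (algebraMap ℝ ℂ) = M.map (algebraMap ℝ ℂ) ^ k :=
      map_pow (algebraMap ℝ ℂ).mapMatrix M k
    rw [← hmap]
    ext i j
    simp [rePart]
  refine .of_nonneg_of_le (fun k => norm_nonneg _) (fun k => ?_)
    ((summable_norm_pow_of_spectralRadius_lt_one hM).mul_left ‖rePart‖)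
  rw [← hre]
  exact rePart.le_opNorm _

lemma summable_transpose_pow_mul_mul_pow {M : Matrix ι ι ℝ} (hM : Summable fun k : ℕ => ‖M ^ k‖)
    (G : Matrix ι ι ℝ) : Summable fun k : ℕ => (M ^ k)ᵀ * G * M ^ k := by
  refine .of_norm_bounded (hM.mul_left ((∑' k, ‖M ^ k‖) * ‖G‖)) fun k => ?_
  calc ‖(M ^ k)ᵀ * G * M ^ k‖ ≤ ‖(M ^ k)ᵀ‖ * ‖G‖ * ‖M ^ k‖ :=
        (norm_mul_le _ _).trans (by gcongr; exact norm_mul_le _ _)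
    _ ≤ (∑' k, ‖M ^ k‖) * ‖G‖ * ‖M ^ k‖ := by
        rw [← conjTranspose_eq_transpose_of_trivial, l2_opNorm_conjTranspose]
        gcongr
        exact hM.le_tsum k fun _ _ => norm_nonneg _

lemma exists_nonneg_transpose_mul_mul_add_eq {M G : Matrix ι ι ℝ}
    (hM : spectralRadius ℂ (M.map (algebraMap ℝ ℂ)) < 1) (hG : 0 ≤ G) :
    ∃ S, 0 ≤ S ∧ Mᵀ * S * M + G = S := by
  have hsum := summable_transpose_pow_mul_mul_pow
    (summable_norm_pow_of_spectralRadius_map_lt_one hM) G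
  refine ⟨∑' k : ℕ, (M ^ k)ᵀ * G * M ^ k,
    tsum_nonneg fun k => transpose_mul_mul_nonneg hG (M ^ k), ?_⟩
  conv_rhs => rw [hsum.tsum_eq_zero_add]
  rw [← hsum.tsum_mul_left, ← (hsum.mul_left _).tsum_mul_right]
  simp [pow_succ, Matrix.mul_assoc, add_comm]

lemma IsSchur.spectralRadius_lt_one {n : ℕ} {M : Matrix (Fin n) (Fin n) ℝ} (hM : IsSchur M) :
    spectralRadius ℂ (M.map (algebraMap ℝ ℂ)) < 1 := by
  obtain h | h := (spectrum ℂ (M.map (algebraMap ℝ ℂ))).eq_empty_or_nonempty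
  · rw [spectralRadius, h]
    simp
  · exact_mod_cast spectrum.spectralRadius_lt_of_forall_lt_of_nonempty h (r := 1)
      fun z hz => by exact_mod_cast hM z hz

end Schur

section ValueIteration

variable {ι κ : Type*} [Fintype ι] [Fintype κ] [DecidableEq κ] {A : Matrix ι ι ℝ}
  {B : Matrix ι κ ℝ} {Q : Matrix ι ι ℝ} {R : Matrix κ κ ℝ}

lemma continuousAt_riccatiMap (hR : R.PosDef) {P : Matrix ι ι ℝ} (hP : 0 ≤ P) :
    ContinuousAt (riccatiMap A B Q R) P := by
  have hG := posDef_add_transpose_mul_mul hR hP B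
  have hdet : (R + Bᵀ * P * B).det ≠ 0 := ((isUnit_iff_isUnit_det _).1 hG.isUnit).ne_zero
  have hinv : ContinuousAt (fun P : Matrix ι ι ℝ => (R + Bᵀ * P * B)⁻¹) P := by
    refine ContinuousAt.comp (f := fun P : Matrix ι ι ℝ => R + Bᵀ * P * B) (g := Inv.inv)
      (continuousAt_matrix_inv _ ?_) (by fun_prop)
    rw [Ring.inverse_eq_inv']
    exact continuousAt_inv₀ hdet
  have hmul : Continuous fun N : Matrix ι ι ℝ × Matrix κ κ ℝ =>
      Aᵀ * N.1 * A - Aᵀ * N.1 * B * N.2 * Bᵀ * N.1 * A + Q := by fun_prop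
  exact ContinuousAt.comp (f := fun P => (P, (R + Bᵀ * P * B)⁻¹)) hmul.continuousAt
    (continuousAt_id.prodMk hinv)

lemma exists_posDef_riccatiMap_eq_self (hQ : Q.PosDef) (hR : R.PosDef) {K : Matrix κ ι ℝ}
    {S : Matrix ι ι ℝ} (hS : 0 ≤ S) (hSsuper : policyMap A B Q R K S ≤ S) :
    ∃ P : Matrix ι ι ℝ, P.PosDef ∧ riccatiMap A B Q R P = P := by
  set p : ℕ → Matrix ι ι ℝ := fun k => (riccatiMap A B Q R)^[k] 0
  have hsucc (k : ℕ) : p (k + 1) = riccatiMap A B Q R (p k) := Function.iterate_succ_apply' ..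
  have hnonneg (k : ℕ) : 0 ≤ p k := by
    induction k with
    | zero => exact le_rfl
    | succ k ih => exact hsucc k ▸ hQ.posSemidef.nonneg.trans (le_riccatiMap hR ih)
  have hmono : Monotone p := monotone_nat_of_le_succ fun k => by
    induction k with
    | zero => exact hnonneg 1
    | succ k ih =>
      rw [hsucc, hsucc]
      exact riccatiMap_mono hR (hnonneg k) ih
  have hle (k : ℕ) : p k ≤ S := by
    refine le_of_le_riccatiMap_of_policyMap_le hQ hR (hnonneg k) ?_ hS hSsuper
    exact hsucc k ▸ hmono k.le_succ
  obtain ⟨P, hP⟩ := exists_tendsto_of_monotone_of_bddAbove hmono ⟨S, Set.forall_mem_range.2 hle⟩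
  have hP0 : 0 ≤ P := ge_of_tendsto' hP hnonneg
  have hfix : riccatiMap A B Q R P = P := by
    refine tendsto_nhds_unique ?_ (hP.comp (tendsto_add_atTop_nat 1))
    simpa only [Function.comp_def, hsucc] using (continuousAt_riccatiMap hR hP0).tendsto.comp hP
  have hQP : Q ≤ P := (le_riccatiMap hR hP0).trans_eq hfix
  exact ⟨P, by simpa using hQ.add_posSemidef (Matrix.le_iff.1 hQP), hfix⟩

end ValueIteration

section RiccatiSolution

variable {n m : ℕ} {A : Matrix (Fin n) (Fin n) ℝ} {B : Matrix (Fin n) (Fin m) ℝ}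
  {Q : Matrix (Fin n) (Fin n) ℝ} {R : Matrix (Fin m) (Fin m) ℝ}

lemma IsRiccatiSolution.eq {P P' : Matrix (Fin n) (Fin n) ℝ} (hQ : Q.PosDef) (hR : R.PosDef)
    (hP : IsRiccatiSolution A B Q R P) (hP' : IsRiccatiSolution A B Q R P') : P = P' := by
  have hle {S T : Matrix (Fin n) (Fin n) ℝ} (hS : IsRiccatiSolution A B Q R S)
      (hT : IsRiccatiSolution A B Q R T) : S ≤ T :=
    le_of_le_riccatiMap_of_policyMap_le hQ hR hS.1.posSemidef.nonneg hS.2.le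
      hT.1.posSemidef.nonneg
      ((policyMap_greedyGain hR hT.1.posSemidef.nonneg).trans hT.2.symm).le
  exact (hle hP hP').antisymm (hle hP' hP)

lemma IsStabilizable.existsUnique_isRiccatiSolution (h : IsStabilizable A B) (hQ : Q.PosDef)
    (hR : R.PosDef) : ∃! P, IsRiccatiSolution A B Q R P := by
  obtain ⟨K, hK⟩ := h
  obtain ⟨S, hS, hSeq⟩ := exists_nonneg_transpose_mul_mul_add_eq hK.spectralRadius_lt_one
    (add_nonneg hQ.posSemidef.nonneg (transpose_mul_mul_nonneg hR.posSemidef.nonneg K))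
  obtain ⟨P, hP, hfix⟩ := exists_posDef_riccatiMap_eq_self hQ hR hS hSeq.le
  exact ⟨P, ⟨hP, hfix.symm⟩, fun P' hP' => hP'.eq hQ hR ⟨hP, hfix.symm⟩⟩

lemma IsStabilizable.isRiccatiSolution_riccatiP (h : IsStabilizable A B) (hQ : Q.PosDef)
    (hR : R.PosDef) : IsRiccatiSolution A B Q R (riccatiP A B Q R) := by
  have hex := (h.existsUnique_isRiccatiSolution hQ hR).exists
  rw [riccatiP, dif_pos hex]
  exact hex.choose_spec

lemma IsStabilizable.riccatiP_nonneg (h : IsStabilizable A B) (hQ : Q.PosDef) (hR : R.PosDef) :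
    0 ≤ riccatiP A B Q R :=
  (h.isRiccatiSolution_riccatiP hQ hR).1.posSemidef.nonneg

lemma IsStabilizable.isHermitian_riccatiP (h : IsStabilizable A B) (hQ : Q.PosDef)
    (hR : R.PosDef) : (riccatiP A B Q R).IsHermitian :=
  (h.isRiccatiSolution_riccatiP hQ hR).1.isHermitian

lemma IsStabilizable.policyMap_lqrGain_riccatiP (h : IsStabilizable A B) (hQ : Q.PosDef)
    (hR : R.PosDef) :
    policyMap A B Q R (lqrGain A B Q R) (riccatiP A B Q R) = riccatiP A B Q R :=
  (policyMap_greedyGain hR (h.riccatiP_nonneg hQ hR)).trans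
    (h.isRiccatiSolution_riccatiP hQ hR).2.symm

lemma IsStabilizable.riccatiP_le_of_policyMap_le (h : IsStabilizable A B) (hQ : Q.PosDef)
    (hR : R.PosDef) {K : Matrix (Fin m) (Fin n) ℝ} {S : Matrix (Fin n) (Fin n) ℝ} (hS : 0 ≤ S)
    (hSsuper : policyMap A B Q R K S ≤ S) : riccatiP A B Q R ≤ S :=
  le_of_le_riccatiMap_of_policyMap_le hQ hR (h.riccatiP_nonneg hQ hR)
    (h.isRiccatiSolution_riccatiP hQ hR).2.le hS hSsuper

end RiccatiSolution

section Perturbation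

variable {n m : ℕ} {A A' : Matrix (Fin n) (Fin n) ℝ} {B B' : Matrix (Fin n) (Fin m) ℝ}
  {Q : Matrix (Fin n) (Fin n) ℝ} {R : Matrix (Fin m) (Fin m) ℝ} {q c ε : ℝ}

lemma riccatiP_le_smul_of_closedLoop_le (h : IsStabilizable A B) (h' : IsStabilizable A' B')
    (hQ : Q.PosDef) (hR : R.PosDef) (hq : 0 < q) (hqQ : q • 1 ≤ Q) (hε : 0 ≤ ε) (hεq : 2 * ε ≤ q)
    (hcl : (A' + B' * lqrGain A B Q R)ᵀ * riccatiP A B Q R * (A' + B' * lqrGain A B Q R) ≤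
      (A + B * lqrGain A B Q R)ᵀ * riccatiP A B Q R * (A + B * lqrGain A B Q R) + ε • 1) :
    riccatiP A' B' Q R ≤ (1 + 2 * ε / q) • riccatiP A B Q R := by
  set K := lqrGain A B Q R
  set P := riccatiP A B Q R
  set δ := 2 * ε / q
  have hδ0 : 0 ≤ δ := by positivity
  have hδq : δ * q = 2 * ε := div_mul_cancel₀ _ hq.ne'
  have hδ1 : δ ≤ 1 := (div_le_one hq).2 hεq
  have hcost : q • 1 ≤ Q + Kᵀ * R * K :=
    hqQ.trans (le_add_of_nonneg_right (transpose_mul_mul_nonneg hR.posSemidef.nonneg K))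
  have hbellman : (A + B * K)ᵀ * P * (A + B * K) + (Q + Kᵀ * R * K) = P :=
    h.policyMap_lqrGain_riccatiP hQ hR
  refine h'.riccatiP_le_of_policyMap_le (K := K) hQ hR
    (smul_nonneg (add_nonneg zero_le_one hδ0) (h.riccatiP_nonneg hQ hR)) ?_
  have habsorb : ((1 + δ) * ε) • (1 : Matrix (Fin n) (Fin n) ℝ) ≤ δ • (Q + Kᵀ * R * K) := calc
    ((1 + δ) * ε) • (1 : Matrix (Fin n) (Fin n) ℝ) ≤ (δ * q) • 1 :=
      smul_le_smul_of_nonneg_right (by nlinarith [hδ1]) PosSemidef.one.nonneg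
    _ ≤ δ • (Q + Kᵀ * R * K) := by
      rw [mul_smul]
      exact smul_le_smul_of_nonneg_left hcost hδ0
  calc policyMap A' B' Q R K ((1 + δ) • P)
      = (1 + δ) • ((A' + B' * K)ᵀ * P * (A' + B' * K)) + (Q + Kᵀ * R * K) := by
        simp [policyMap]
    _ ≤ (1 + δ) • ((A + B * K)ᵀ * P * (A + B * K) + ε • 1) + (Q + Kᵀ * R * K) := by gcongr
    _ = (1 + δ) • ((A + B * K)ᵀ * P * (A + B * K)) + (Q + Kᵀ * R * K) + ((1 + δ) * ε) • 1 := by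
        rw [smul_add, smul_smul]
        abel
    _ ≤ (1 + δ) • ((A + B * K)ᵀ * P * (A + B * K)) + (Q + Kᵀ * R * K) + δ • (Q + Kᵀ * R * K) := by
        gcongr
    _ = (1 + δ) • P := by
        conv_rhs => rw [← hbellman]
        module

lemma riccatiP_le_add_smul_one_of_closedLoop_le (h : IsStabilizable A B)
    (h' : IsStabilizable A' B') (hQ : Q.PosDef) (hR : R.PosDef) (hq : 0 < q) (hqQ : q • 1 ≤ Q)
    (hc : 0 ≤ c) (hP : riccatiP A B Q R ≤ c • 1) (hP' : riccatiP A' B' Q R ≤ c • 1) (hε : 0 ≤ ε)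
    (hcl : (A' + B' * lqrGain A B Q R)ᵀ * riccatiP A B Q R * (A' + B' * lqrGain A B Q R) ≤
      (A + B * lqrGain A B Q R)ᵀ * riccatiP A B Q R * (A + B * lqrGain A B Q R) + ε • 1) :
    riccatiP A' B' Q R ≤ riccatiP A B Q R + (2 * ε / q * c) • 1 := by
  obtain hεq | hεq := le_total (2 * ε) q
  · refine (riccatiP_le_smul_of_closedLoop_le h h' hQ hR hq hqQ hε hεq hcl).trans ?_
    rw [add_smul, one_smul, mul_smul]
    gcongr
  · calc riccatiP A' B' Q R ≤ c • 1 := hP'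
      _ ≤ (2 * ε / q * c) • 1 := smul_le_smul_of_nonneg_right
        (le_mul_of_one_le_left hc ((one_le_div hq).2 hεq)) PosSemidef.one.nonneg
      _ ≤ riccatiP A B Q R + (2 * ε / q * c) • 1 :=
        le_add_of_nonneg_left (h.riccatiP_nonneg hQ hR)

lemma mul_sq_norm_lqrGain_le (h : IsStabilizable A B) (hQ : Q.PosDef) (hR : R.PosDef) {r : ℝ}
    (hr : 0 ≤ r) (hrR : r • 1 ≤ R) (hc : 0 ≤ c) (hP : riccatiP A B Q R ≤ c • 1) :
    r * ‖lqrGain A B Q R‖ ^ 2 ≤ c := by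
  refine mul_sq_norm_le_of_transpose_mul_mul_le hr hc hrR (le_trans ?_ hP)
  calc (lqrGain A B Q R)ᵀ * R * lqrGain A B Q R
      ≤ policyMap A B Q R (lqrGain A B Q R) (riccatiP A B Q R) :=
        (le_add_of_nonneg_left hQ.posSemidef.nonneg).trans
          (le_add_of_nonneg_left (transpose_mul_mul_nonneg (h.riccatiP_nonneg hQ hR) _))
    _ = riccatiP A B Q R := h.policyMap_lqrGain_riccatiP hQ hR

end Perturbation

section ParameterFamily

variable {E : Type*} {n m : ℕ} {A : E → Matrix (Fin n) (Fin n) ℝ} {B : E → Matrix (Fin n) (Fin m) ℝ}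
  {Q : Matrix (Fin n) (Fin n) ℝ} {R : Matrix (Fin m) (Fin m) ℝ} {Θ : Set E}

lemma eventually_riccatiP_le_smul [TopologicalSpace E] (hA : ContinuousOn A Θ)
    (hB : ContinuousOn B Θ) (hstab : ∀ θ ∈ Θ, IsStabilizable (A θ) (B θ)) (hQ : Q.PosDef)
    (hR : R.PosDef) {θ : E} (hθ : θ ∈ Θ) :
    ∀ᶠ θ' in 𝓝[Θ] θ, riccatiP (A θ') (B θ') Q R ≤ (2 : ℝ) • riccatiP (A θ) (B θ) Q R := by
  obtain ⟨q, hq, hqQ⟩ := exists_pos_smul_one_le hQ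
  set K := lqrGain (A θ) (B θ) Q R
  set P := riccatiP (A θ) (B θ) Q R
  have hM : ContinuousWithinAt (fun θ' => A θ' + B θ' * K) Θ θ :=
    (show Continuous fun N : Matrix (Fin n) (Fin n) ℝ × Matrix (Fin n) (Fin m) ℝ =>
      N.1 + N.2 * K by fun_prop).continuousAt.comp_continuousWithinAt
        ((hA θ hθ).prodMk (hB θ hθ))
  have hclose : Tendsto (fun θ' => ‖P‖ * ‖A θ' + B θ' * K - (A θ + B θ * K)‖ *
      (‖A θ + B θ * K‖ + ‖A θ' + B θ' * K‖)) (𝓝[Θ] θ) (𝓝 0) := by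
    simpa using ((hM.sub_const (A θ + B θ * K)).norm.const_mul ‖P‖).mul
      (hM.norm.const_add ‖A θ + B θ * K‖)
  filter_upwards [hclose.eventually_le_const (half_pos hq), self_mem_nhdsWithin] with θ' hε hθ'
  refine (riccatiP_le_smul_of_closedLoop_le (hstab θ hθ) (hstab θ' hθ') hQ hR hq hqQ
    (half_pos hq).le (mul_div_cancel₀ q two_ne_zero).le ?_).trans_eq ?_
  · exact (transpose_mul_mul_le_add_smul_one
      ((hstab θ hθ).isHermitian_riccatiP hQ hR) _ _).trans
      (by gcongr)
  · rw [mul_div_cancel₀ q two_ne_zero, div_self hq.ne', one_add_one_eq_two]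

lemma exists_norm_riccatiP_le [TopologicalSpace E] (hA : ContinuousOn A Θ)
    (hB : ContinuousOn B Θ) (hΘ : IsCompact Θ) (hstab : ∀ θ ∈ Θ, IsStabilizable (A θ) (B θ))
    (hQ : Q.PosDef) (hR : R.PosDef) :
    ∃ c, ∀ θ ∈ Θ, ‖riccatiP (A θ) (B θ) Q R‖ ≤ c := by
  refine hΘ.induction_on (p := fun s => ∃ c, ∀ θ ∈ s, ‖riccatiP (A θ) (B θ) Q R‖ ≤ c)
    ⟨0, by simp⟩ (fun s t hst ⟨c, hc⟩ => ⟨c, fun θ hθ => hc θ (hst hθ)⟩)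
    (fun s t ⟨c, hc⟩ ⟨d, hd⟩ => ⟨max c d, fun θ hθ => hθ.elim
      (fun h => (hc θ h).trans (le_max_left c d)) fun h => (hd θ h).trans (le_max_right c d)⟩)
    fun θ hθ => ?_
  refine ⟨_, (eventually_riccatiP_le_smul hA hB hstab hQ hR hθ).and self_mem_nhdsWithin,
    2 * ‖riccatiP (A θ) (B θ) Q R‖, fun θ' ⟨hle, hθ'⟩ => ?_⟩
  refine norm_le_of_le_smul_one ((hstab θ' hθ').riccatiP_nonneg hQ hR) (by positivity)
    (hle.trans ?_)
  rw [mul_smul]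
  gcongr
  exact le_norm_smul_one ((hstab θ hθ).isHermitian_riccatiP hQ hR)

lemma exists_norm_lqrGain_le [TopologicalSpace E] (hA : ContinuousOn A Θ)
    (hB : ContinuousOn B Θ) (hΘ : IsCompact Θ) (hstab : ∀ θ ∈ Θ, IsStabilizable (A θ) (B θ))
    (hQ : Q.PosDef) (hR : R.PosDef) :
    ∃ k, ∀ θ ∈ Θ, ‖lqrGain (A θ) (B θ) Q R‖ ≤ k := by
  obtain ⟨r, hr, hrR⟩ := exists_pos_smul_one_le hR
  obtain ⟨c, hc⟩ := exists_norm_riccatiP_le hA hB hΘ hstab hQ hR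
  refine ⟨√(c / r), fun θ hθ => Real.le_sqrt_of_sq_le ?_⟩
  rw [le_div_iff₀' hr]
  exact (mul_sq_norm_lqrGain_le (hstab θ hθ) hQ hR hr.le hrR (norm_nonneg _)
    (le_norm_smul_one ((hstab θ hθ).isHermitian_riccatiP hQ hR))).trans
    (hc θ hθ)

lemma exists_norm_closedLoop_le [TopologicalSpace E] (hA : ContinuousOn A Θ)
    (hB : ContinuousOn B Θ) (hΘ : IsCompact Θ) (hstab : ∀ θ ∈ Θ, IsStabilizable (A θ) (B θ))
    (hQ : Q.PosDef) (hR : R.PosDef) :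
    ∃ κ, ∀ θ ∈ Θ, ∀ θ' ∈ Θ, ‖A θ' + B θ' * lqrGain (A θ) (B θ) Q R‖ ≤ κ := by
  obtain ⟨a, ha⟩ := hΘ.exists_bound_of_continuousOn hA
  obtain ⟨b, hb⟩ := hΘ.exists_bound_of_continuousOn hB
  obtain ⟨k, hk⟩ := exists_norm_lqrGain_le hA hB hΘ hstab hQ hR
  refine ⟨a + b * k, fun θ hθ θ' hθ' => norm_add_le_of_le (ha θ' hθ') ?_⟩
  exact (l2_opNorm_mul _ _).trans
    (mul_le_mul (hb θ' hθ') (hk θ hθ) (norm_nonneg _) ((norm_nonneg _).trans (hb θ' hθ')))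

lemma lipschitzOnWith_closedLoop [PseudoMetricSpace E] {a b : ℝ≥0} (hA : LipschitzOnWith a A Θ)
    (hB : LipschitzOnWith b B Θ) (K : Matrix (Fin m) (Fin n) ℝ) :
    LipschitzOnWith (a + b * ‖K‖₊) (fun θ => A θ + B θ * K) Θ := by
  refine .of_dist_le_mul fun θ hθ θ' hθ' => ?_
  have hA' : ‖A θ - A θ'‖ ≤ a * dist θ θ' :=
    (dist_eq_norm (A θ) (A θ')).symm.trans_le (hA.dist_le_mul θ hθ θ' hθ')
  have hB' : ‖B θ - B θ'‖ ≤ b * dist θ θ' :=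
    (dist_eq_norm (B θ) (B θ')).symm.trans_le (hB.dist_le_mul θ hθ θ' hθ')
  calc dist (A θ + B θ * K) (A θ' + B θ' * K) = ‖(A θ - A θ') + (B θ - B θ') * K‖ := by
        rw [dist_eq_norm, Matrix.sub_mul, add_sub_add_comm]
    _ ≤ a * dist θ θ' + b * dist θ θ' * ‖K‖ := by
        refine norm_add_le_of_le hA' ((l2_opNorm_mul _ _).trans ?_)
        gcongr
    _ = ↑(a + b * ‖K‖₊) * dist θ θ' := by
        push_cast
        ring

lemma exists_riccatiP_le_add_dist_smul_one [PseudoMetricSpace E] {a b : ℝ≥0}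
    (hA : LipschitzOnWith a A Θ) (hB : LipschitzOnWith b B Θ) (hΘ : IsCompact Θ)
    (hstab : ∀ θ ∈ Θ, IsStabilizable (A θ) (B θ)) (hQ : Q.PosDef) (hR : R.PosDef) :
    ∃ L : ℝ, ∀ θ ∈ Θ, ∀ θ' ∈ Θ,
      riccatiP (A θ') (B θ') Q R ≤ riccatiP (A θ) (B θ) Q R + (L * dist θ' θ) • 1 := by
  obtain ⟨q, hq, hqQ⟩ := exists_pos_smul_one_le hQ
  obtain ⟨c, hc⟩ := exists_norm_riccatiP_le hA.continuousOn hB.continuousOn hΘ hstab hQ hR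
  obtain ⟨k, hk⟩ := exists_norm_lqrGain_le hA.continuousOn hB.continuousOn hΘ hstab hQ hR
  obtain ⟨κ, hκ⟩ := exists_norm_closedLoop_le hA.continuousOn hB.continuousOn hΘ hstab hQ hR
  refine ⟨2 * (c * (a + b * k) * (κ + κ)) / q * c, fun θ hθ θ' hθ' => ?_⟩
  have hc0 : 0 ≤ c := (norm_nonneg _).trans (hc θ hθ)
  have hk0 : 0 ≤ k := (norm_nonneg _).trans (hk θ hθ)
  have hκ0 : 0 ≤ κ := (norm_nonneg _).trans (hκ θ hθ θ hθ)
  have hle {η : E} (hη : η ∈ Θ) : riccatiP (A η) (B η) Q R ≤ c • 1 :=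
    (le_norm_smul_one ((hstab η hη).isHermitian_riccatiP hQ hR)).trans
      (smul_le_smul_of_nonneg_right (hc η hη) PosSemidef.one.nonneg)
  set K := lqrGain (A θ) (B θ) Q R
  have hdiff : ‖A θ' + B θ' * K - (A θ + B θ * K)‖ ≤ (a + b * k) * dist θ' θ := calc
    ‖A θ' + B θ' * K - (A θ + B θ * K)‖ ≤ (a + b * ‖K‖) * dist θ' θ := by
      simpa [dist_eq_norm] using (lipschitzOnWith_closedLoop hA hB K).dist_le_mul θ' hθ' θ hθ
    _ ≤ (a + b * k) * dist θ' θ := by gcongr; exact hk θ hθ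
  have hcl : (A θ' + B θ' * K)ᵀ * riccatiP (A θ) (B θ) Q R * (A θ' + B θ' * K) ≤
      (A θ + B θ * K)ᵀ * riccatiP (A θ) (B θ) Q R * (A θ + B θ * K) +
        (c * ((a + b * k) * dist θ' θ) * (κ + κ)) • 1 := by
    refine (transpose_mul_mul_le_add_smul_one ((hstab θ hθ).isHermitian_riccatiP hQ hR)
      (A θ + B θ * K) (A θ' + B θ' * K)).trans ?_
    gcongr
    exacts [hc θ hθ, hκ θ hθ θ hθ, hκ θ hθ θ' hθ']
  refine (riccatiP_le_add_smul_one_of_closedLoop_le (hstab θ hθ) (hstab θ' hθ') hQ hR hq hqQ hc0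
    (hle hθ) (hle hθ') (by positivity) hcl).trans_eq ?_
  ring_nf

lemma exists_lipschitzOnWith_riccatiP [PseudoMetricSpace E] {a b : ℝ≥0}
    (hA : LipschitzOnWith a A Θ) (hB : LipschitzOnWith b B Θ) (hΘ : IsCompact Θ)
    (hstab : ∀ θ ∈ Θ, IsStabilizable (A θ) (B θ)) (hQ : Q.PosDef) (hR : R.PosDef) :
    ∃ L, LipschitzOnWith L (fun θ => riccatiP (A θ) (B θ) Q R) Θ := by
  obtain ⟨L, hL⟩ := exists_riccatiP_le_add_dist_smul_one hA hB hΘ hstab hQ hR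
  refine ⟨L.toNNReal, .of_dist_le_mul fun θ hθ θ' hθ' => ?_⟩
  have hnonneg : 0 ≤ L.toNNReal * dist θ θ' := by positivity
  have hle {η η' : E} (hη : η ∈ Θ) (hη' : η' ∈ Θ) :
      riccatiP (A η') (B η') Q R ≤ riccatiP (A η) (B η) Q R + (L.toNNReal * dist η' η) • 1 :=
    (hL η hη η' hη').trans <| by
      gcongr
      exact L.le_coe_toNNReal
  rw [dist_eq_norm, norm_le_iff_of_isHermitian (((hstab θ hθ).isHermitian_riccatiP hQ hR).sub
    ((hstab θ' hθ').isHermitian_riccatiP hQ hR)) hnonneg]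
  refine ⟨neg_le_sub_iff_le_add.2 ?_, sub_le_iff_le_add'.2 (hle hθ' hθ)⟩
  simpa [dist_comm θ θ'] using hle hθ hθ'

end ParameterFamily

section QuadForm

variable {ι : Type*} [Fintype ι]

/-- The quadratic form `xᵀ P x` on Euclidean space; `lyapunovV` is this form for the Riccati
solution. -/
def quadForm (P : Matrix ι ι ℝ) (x : EuclideanSpace ℝ ι) : ℝ :=
  x.ofLp ⬝ᵥ (P *ᵥ x.ofLp)

lemma quadForm_mono {P S : Matrix ι ι ℝ} (h : P ≤ S) (x : EuclideanSpace ℝ ι) :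
    quadForm P x ≤ quadForm S x :=
  dotProduct_mulVec_mono h x.ofLp

lemma quadForm_add_left (P S : Matrix ι ι ℝ) (x : EuclideanSpace ℝ ι) :
    quadForm (P + S) x = quadForm P x + quadForm S x := by
  rw [quadForm, add_mulVec, dotProduct_add, quadForm, quadForm]

lemma quadForm_smul_one [DecidableEq ι] (t : ℝ) (x : EuclideanSpace ℝ ι) :
    quadForm (t • 1) x = t * ‖x‖ ^ 2 := by
  rw [quadForm, smul_mulVec, one_mulVec, dotProduct_smul, smul_eq_mul,
    EuclideanSpace.real_norm_sq_eq]
  simp only [dotProduct, sq]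

lemma quadForm_transpose_mul_mul {n m : ℕ} (P : Matrix (Fin m) (Fin m) ℝ)
    (M : Matrix (Fin m) (Fin n) ℝ) (x : EuclideanSpace ℝ (Fin n)) :
    quadForm (Mᵀ * P * M) x = quadForm P (mulE M x) := by
  simp only [quadForm, mulE, ← mulVec_mulVec, dotProduct_mulVec, vecMul_transpose]

lemma mulE_add_mul {n m : ℕ} (A : Matrix (Fin n) (Fin n) ℝ) (B : Matrix (Fin n) (Fin m) ℝ)
    (K : Matrix (Fin m) (Fin n) ℝ) (x : EuclideanSpace ℝ (Fin n)) :
    mulE (A + B * K) x = mulE A x + mulE B (mulE K x) := by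
  simp [mulE, add_mulVec]

lemma norm_mulE_le {n m : ℕ} {M : Matrix (Fin m) (Fin n) ℝ} {κ : ℝ} (hM : ‖M‖ ≤ κ)
    (x : EuclideanSpace ℝ (Fin n)) : ‖mulE M x‖ ≤ κ * ‖x‖ :=
  (l2_opNorm_mulVec M x).trans (by gcongr)

variable [DecidableEq ι]

lemma dotProduct_mulVec_le_norm_mul (P : Matrix ι ι ℝ) (x y : EuclideanSpace ℝ ι) :
    x.ofLp ⬝ᵥ (P *ᵥ y.ofLp) ≤ ‖P‖ * ‖x‖ * ‖y‖ := calc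
  x.ofLp ⬝ᵥ (P *ᵥ y.ofLp) = inner ℝ (WithLp.toLp 2 (P *ᵥ y.ofLp)) x := by
    rw [EuclideanSpace.inner_eq_star_dotProduct, star_trivial]
  _ ≤ ‖WithLp.toLp 2 (P *ᵥ y.ofLp)‖ * ‖x‖ := real_inner_le_norm _ _
  _ ≤ ‖P‖ * ‖y‖ * ‖x‖ := by
    gcongr
    exact l2_opNorm_mulVec P y
  _ = ‖P‖ * ‖x‖ * ‖y‖ := mul_right_comm ..

lemma quadForm_add_right_le {P : Matrix ι ι ℝ} (hP : P.IsHermitian) (y d : EuclideanSpace ℝ ι) :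
    quadForm P (y + d) ≤ quadForm P y + ‖P‖ * (2 * ‖y‖ * ‖d‖ + ‖d‖ ^ 2) := by
  have hsymm : d.ofLp ⬝ᵥ (P *ᵥ y.ofLp) = y.ofLp ⬝ᵥ (P *ᵥ d.ofLp) := by
    rw [dotProduct_mulVec, ← mulVec_transpose, dotProduct_comm, show Pᵀ = P from hP]
  have hexpand : quadForm P (y + d) =
      quadForm P y + 2 * (y.ofLp ⬝ᵥ (P *ᵥ d.ofLp)) + d.ofLp ⬝ᵥ (P *ᵥ d.ofLp) := by
    simp only [quadForm, WithLp.ofLp_add, mulVec_add, dotProduct_add, add_dotProduct, hsymm]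
    ring
  linarith [dotProduct_mulVec_le_norm_mul P y d, dotProduct_mulVec_le_norm_mul P d d]

lemma quadForm_le_of_le_add_smul_one {P P' : Matrix ι ι ℝ} {t : ℝ} (h : P' ≤ P + t • 1)
    (x : EuclideanSpace ℝ ι) : quadForm P' x ≤ quadForm P x + t * ‖x‖ ^ 2 :=
  (quadForm_mono h x).trans_eq (by rw [quadForm_add_left, quadForm_smul_one])

end QuadForm

section LyapunovDecrease

lemma quadForm_add_sub_le_of_nominal_decrease {ι : Type*} [Fintype ι] [DecidableEq ι]
    {P P' : Matrix ι ι ℝ} {x y d : EuclideanSpace ℝ ι}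
    {q κ c η X : ℝ} (hq : 0 < q) (hη : 0 ≤ η) (hP : P.IsHermitian) (hPc : ‖P‖ ≤ c)
    (hP' : P' ≤ P + (η * ‖d‖) • 1) (hnominal : quadForm P y ≤ quadForm P x - q * ‖x‖ ^ 2)
    (hy : ‖y‖ ≤ κ * ‖x‖) (hX : ‖y + d‖ ≤ X) :
    quadForm P' (y + d) - quadForm P x ≤ -(q / 2) * ‖x‖ ^ 2 +
      (κ ^ 2 * (2 * c + η * X) ^ 2 / (2 * q) + (c + η * X)) * ‖d‖ ^ 2 := by
  have hX0 : 0 ≤ X := (norm_nonneg _).trans hX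
  have hc0 : 0 ≤ c := (norm_nonneg _).trans hPc
  have hparam : (η * ‖d‖) * ‖y + d‖ ^ 2 ≤ η * X * (‖y‖ * ‖d‖ + ‖d‖ ^ 2) := calc
    (η * ‖d‖) * ‖y + d‖ ^ 2 = (η * ‖d‖) * (‖y + d‖ * ‖y + d‖) := by rw [sq]
    _ ≤ (η * ‖d‖) * (X * (‖y‖ + ‖d‖)) := by
      gcongr
      exact norm_add_le y d
    _ = η * X * (‖y‖ * ‖d‖ + ‖d‖ ^ 2) := by ring
  have hstate : ‖P‖ * (2 * ‖y‖ * ‖d‖ + ‖d‖ ^ 2) ≤ c * (2 * ‖y‖ * ‖d‖ + ‖d‖ ^ 2) := by gcongr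
  have hcross : (2 * c + η * X) * (‖y‖ * ‖d‖) ≤ (2 * c + η * X) * (κ * ‖x‖ * ‖d‖) := by gcongr
  have hyoung : (2 * c + η * X) * (κ * ‖x‖ * ‖d‖) ≤
      q / 2 * ‖x‖ ^ 2 + κ ^ 2 * (2 * c + η * X) ^ 2 / (2 * q) * ‖d‖ ^ 2 := by
    have hsq : 0 ≤ (q * ‖x‖ - κ * (2 * c + η * X) * ‖d‖) ^ 2 / (2 * q) := by positivity
    have hexpand : (q * ‖x‖ - κ * (2 * c + η * X) * ‖d‖) ^ 2 / (2 * q) =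
        q / 2 * ‖x‖ ^ 2 + κ ^ 2 * (2 * c + η * X) ^ 2 / (2 * q) * ‖d‖ ^ 2
          - (2 * c + η * X) * (κ * ‖x‖ * ‖d‖) := by
      field_simp
      ring
    linarith
  linarith [quadForm_le_of_le_add_smul_one hP' (y + d), quadForm_add_right_le hP y d]

-- The left-hand side is the coefficient of `‖d‖ ^ 2` above for `η = L * √μ`; completing the square
-- in `√μ * X` trades it for an affine function of `μ * X ^ 2`.
lemma disturbance_gain_le {q L κ c X μ : ℝ} (hq : 0 < q) (hL : 0 ≤ L) (hμ : 0 ≤ μ) :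
    κ ^ 2 * (2 * c + L * √μ * X) ^ 2 / (2 * q) + (c + L * √μ * X) ≤
      (κ ^ 2 * L ^ 2 / q + L / 2) * μ * X ^ 2 + (4 * κ ^ 2 * c ^ 2 / q + |c| + L / 2) := by
  have hsq : (√μ * X) ^ 2 = μ * X ^ 2 := by rw [mul_pow, Real.sq_sqrt hμ]
  have hquad : (2 * c + L * (√μ * X)) ^ 2 ≤ 2 * ((2 * c) ^ 2 + L ^ 2 * (μ * X ^ 2)) := by
    rw [← hsq, ← mul_pow]
    exact add_sq_le
  have hlin : √μ * X ≤ (μ * X ^ 2 + 1) / 2 := by linarith [two_mul_le_add_sq (√μ * X) 1]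
  calc κ ^ 2 * (2 * c + L * √μ * X) ^ 2 / (2 * q) + (c + L * √μ * X)
      ≤ κ ^ 2 * (2 * ((2 * c) ^ 2 + L ^ 2 * (μ * X ^ 2))) / (2 * q)
          + (|c| + L * ((μ * X ^ 2 + 1) / 2)) := by
        rw [mul_assoc L]
        gcongr
        exact le_abs_self c
    _ = _ := by
        field_simp
        ring

lemma quadForm_riccatiP_closedLoop_le {n m : ℕ} {A : Matrix (Fin n) (Fin n) ℝ}
    {B : Matrix (Fin n) (Fin m) ℝ} {Q : Matrix (Fin n) (Fin n) ℝ} {R : Matrix (Fin m) (Fin m) ℝ}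
    {q : ℝ} (h : IsStabilizable A B) (hQ : Q.PosDef) (hR : R.PosDef) (hqQ : q • 1 ≤ Q)
    (x : EuclideanSpace ℝ (Fin n)) :
    quadForm (riccatiP A B Q R) (mulE (A + B * lqrGain A B Q R) x) ≤
      quadForm (riccatiP A B Q R) x - q * ‖x‖ ^ 2 := by
  rw [le_sub_iff_add_le, ← quadForm_smul_one, ← quadForm_transpose_mul_mul, ← quadForm_add_left]
  refine quadForm_mono (le_trans ?_ (h.policyMap_lqrGain_riccatiP hQ hR).le) x
  exact add_le_add_right (hqQ.trans
    (le_add_of_nonneg_right (transpose_mul_mul_nonneg hR.posSemidef.nonneg _))) _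

lemma exists_quadForm_riccatiP_sub_le {E : Type*} [PseudoMetricSpace E] {n m : ℕ}
    {A : E → Matrix (Fin n) (Fin n) ℝ} {B : E → Matrix (Fin n) (Fin m) ℝ} {a b : ℝ≥0} {Θ : Set E}
    {Q : Matrix (Fin n) (Fin n) ℝ} {R : Matrix (Fin m) (Fin m) ℝ} (hA : LipschitzOnWith a A Θ)
    (hB : LipschitzOnWith b B Θ) (hΘ : IsCompact Θ) (hstab : ∀ θ ∈ Θ, IsStabilizable (A θ) (B θ))
    (hQ : Q.PosDef) (hR : R.PosDef) :
    ∃ α ν ν' : ℝ, 0 < α ∧ 0 ≤ ν ∧ 0 ≤ ν' ∧ ∀ X μ : ℝ, 0 ≤ μ → ∀ θ ∈ Θ, ∀ θ' ∈ Θ,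
      ∀ x d : EuclideanSpace ℝ (Fin n),
        ‖mulE (A θ + B θ * lqrGain (A θ) (B θ) Q R) x + d‖ ≤ X → dist θ' θ ≤ √μ * ‖d‖ →
        quadForm (riccatiP (A θ') (B θ') Q R)
            (mulE (A θ + B θ * lqrGain (A θ) (B θ) Q R) x + d)
            - quadForm (riccatiP (A θ) (B θ) Q R) x
          ≤ -α * ‖x‖ ^ 2 + (ν * μ * X ^ 2 + ν') * ‖d‖ ^ 2 := by
  obtain ⟨q, hq, hqQ⟩ := exists_pos_smul_one_le hQ
  obtain ⟨c, hc⟩ := exists_norm_riccatiP_le hA.continuousOn hB.continuousOn hΘ hstab hQ hR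
  obtain ⟨κ, hκ⟩ := exists_norm_closedLoop_le hA.continuousOn hB.continuousOn hΘ hstab hQ hR
  obtain ⟨L, hL⟩ := exists_lipschitzOnWith_riccatiP hA hB hΘ hstab hQ hR
  refine ⟨q / 2, κ ^ 2 * L ^ 2 / q + L / 2, 4 * κ ^ 2 * c ^ 2 / q + |c| + L / 2, by positivity,
    by positivity, by positivity, fun X μ hμ θ hθ θ' hθ' x d hX hdist => ?_⟩
  have hP {η : E} (hη : η ∈ Θ) : (riccatiP (A η) (B η) Q R).IsHermitian :=
    (hstab η hη).isHermitian_riccatiP hQ hR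
  have hvar : ‖riccatiP (A θ') (B θ') Q R - riccatiP (A θ) (B θ) Q R‖ ≤ L * √μ * ‖d‖ := calc
    ‖riccatiP (A θ') (B θ') Q R - riccatiP (A θ) (B θ) Q R‖ ≤ L * dist θ' θ := by
      rw [← dist_eq_norm]
      exact hL.dist_le_mul θ' hθ' θ hθ
    _ ≤ L * √μ * ‖d‖ := by
      rw [mul_assoc]
      gcongr
  refine (quadForm_add_sub_le_of_nominal_decrease hq (by positivity) (hP hθ) (hc θ hθ)
    (le_add_smul_one_of_norm_sub_le (hP hθ) (hP hθ') hvar)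
    (quadForm_riccatiP_closedLoop_le (hstab θ hθ) hQ hR hqQ x)
    (norm_mulE_le (hκ θ hθ θ hθ) x) hX).trans ?_
  exact add_le_add_right
    (mul_le_mul_of_nonneg_right (disturbance_gain_le hq L.2 hμ) (sq_nonneg ‖d‖)) _

end LyapunovDecrease

end AdaptiveLQR

end

open AdaptiveLQR NNReal Matrix.Norms.L2Operator in
theorem proposition2_general {E : Type*} [PseudoMetricSpace E] {n m : ℕ}
    {A : E → Matrix (Fin n) (Fin n) ℝ} {B : E → Matrix (Fin n) (Fin m) ℝ} {a b : ℝ≥0} {Θ : Set E}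
    (hA : LipschitzOnWith a A Θ) (hB : LipschitzOnWith b B Θ)
    {Q : Matrix (Fin n) (Fin n) ℝ} (hQ : Q.PosDef) {R : Matrix (Fin m) (Fin m) ℝ} (hR : R.PosDef)
    (hΘ : IsCompact Θ) (hstab : ∀ θ ∈ Θ, IsStabilizable (A θ) (B θ)) :
    (∀ θ ∈ Θ, ∃! P, IsRiccatiSolution (A θ) (B θ) Q R P) ∧
    ∃ α ν₂ ν₃ ν₄ : ℝ, 0 < α ∧ 0 < ν₂ ∧ 0 < ν₃ ∧ 0 < ν₄ ∧
      ∀ X μ : ℝ, 0 < μ →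
        ∃ β γ : ℝ, 0 < β ∧ 0 < γ ∧ β = ν₂ * μ * X ^ 2 + ν₃ * μ + ν₄ ∧
          ∀ θ ∈ Θ, ∀ θ' ∈ Θ, ∀ x z e w : EuclideanSpace ℝ (Fin n),
            e = z - (mulE (A θ) x + mulE (B θ) (mulE (lqrGain (A θ) (B θ) Q R) x)) - w →
            ‖z‖ ≤ X →
            dist θ' θ ≤ √μ * ‖e + w‖ →
            quadForm (riccatiP (A θ') (B θ') Q R) z - quadForm (riccatiP (A θ) (B θ) Q R) x
              ≤ -α * ‖x‖ ^ 2 + β * ‖e‖ ^ 2 + γ * ‖w‖ ^ 2 := by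
  obtain ⟨α, ν, ν', hα, hν, hν', hdecrease⟩ :=
    exists_quadForm_riccatiP_sub_le hA hB hΘ hstab hQ hR
  refine ⟨fun θ hθ => (hstab θ hθ).existsUnique_isRiccatiSolution hQ hR, α, 2 * ν + 1, 1,
    2 * ν' + 1, hα, by positivity, one_pos, by positivity, fun X μ hμ => ?_⟩
  set β := (2 * ν + 1) * μ * X ^ 2 + 1 * μ + (2 * ν' + 1)
  refine ⟨β, β, by positivity, by positivity, rfl, fun θ hθ θ' hθ' x z e w he hz hdist => ?_⟩
  have hstep : z = mulE (A θ + B θ * lqrGain (A θ) (B θ) Q R) x + (e + w) := by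
    rw [he, mulE_add_mul]
    abel
  have hsplit : ‖e + w‖ ^ 2 ≤ 2 * (‖e‖ ^ 2 + ‖w‖ ^ 2) :=
    (pow_le_pow_left₀ (norm_nonneg _) (norm_add_le e w) 2).trans add_sq_le
  have hgain : (ν * μ * X ^ 2 + ν') * 2 ≤ β := by
    have : 0 ≤ μ * X ^ 2 := by positivity
    linarith
  calc _ ≤ -α * ‖x‖ ^ 2 + (ν * μ * X ^ 2 + ν') * ‖e + w‖ ^ 2 :=
        hstep ▸ hdecrease X μ hμ.le θ hθ θ' hθ' x (e + w) (hstep ▸ hz) hdist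
    _ ≤ -α * ‖x‖ ^ 2 + (ν * μ * X ^ 2 + ν') * (2 * (‖e‖ ^ 2 + ‖w‖ ^ 2)) := by gcongr
    _ ≤ -α * ‖x‖ ^ 2 + β * (‖e‖ ^ 2 + ‖w‖ ^ 2) := by
        rw [← mul_assoc]
        gcongr
    _ = -α * ‖x‖ ^ 2 + β * ‖e‖ ^ 2 + β * ‖w‖ ^ 2 := by ring

theorem proposition2 {n m p : ℕ}
    (A : EuclideanSpace ℝ (Fin p) →ᵃ[ℝ] Matrix (Fin n) (Fin n) ℝ)
    (B : EuclideanSpace ℝ (Fin p) →ᵃ[ℝ] Matrix (Fin n) (Fin m) ℝ)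
    (Q : Matrix (Fin n) (Fin n) ℝ) (hQ : Q.PosDef)
    (R : Matrix (Fin m) (Fin m) ℝ) (hR : R.PosDef)
    (Θ : Set (EuclideanSpace ℝ (Fin p))) (hΘcompact : IsCompact Θ) (hΘconvex : Convex ℝ Θ)
    (hΘstab : ∀ θ ∈ Θ, AdaptiveLQR.IsStabilizable (A θ) (B θ))
    (W : ℝ) (hW : 0 ≤ W) :
    (∀ θ ∈ Θ, ∃! P, AdaptiveLQR.IsRiccatiSolution (A θ) (B θ) Q R P) ∧
    ∃ α ν₂ ν₃ ν₄ : ℝ, 0 < α ∧ 0 < ν₂ ∧ 0 < ν₃ ∧ 0 < ν₄ ∧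
      ∀ X μ : ℝ, 0 < μ →
        ∃ β γ : ℝ, 0 < β ∧ 0 < γ ∧ β = ν₂ * μ * X ^ 2 + ν₃ * μ + ν₄ ∧
          ∀ (x w e : ℕ → EuclideanSpace ℝ (Fin n)) (u : ℕ → EuclideanSpace ℝ (Fin m))
            (θ θhat : ℕ → EuclideanSpace ℝ (Fin p)),
            (∀ k, x (k + 1) = AdaptiveLQR.mulE (A (θ k)) (x k)
              + AdaptiveLQR.mulE (B (θ k)) (u k) + w k) →
            (∀ k, u k = AdaptiveLQR.mulE
              (AdaptiveLQR.lqrGain (A (θhat k)) (B (θhat k)) Q R) (x k)) →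
            (∀ k, e k = AdaptiveLQR.predError A B (θhat k) (x k) (u k) (x (k + 1)) (w k)) →
            (∀ k, ‖w k‖ ≤ W) →
            (∀ k, θ k ∈ Θ) →
            (∀ k, θhat k ∈ Θ) →
            (∀ k, ‖x k‖ ≤ X) →
            (∀ k, ‖θhat (k + 1) - θhat k‖ ≤ √μ * ‖e k + w k‖) →
            ∀ k, AdaptiveLQR.lyapunovV A B Q R (x (k + 1)) (θhat (k + 1))
                - AdaptiveLQR.lyapunovV A B Q R (x k) (θhat k)
              ≤ -α * ‖x k‖ ^ 2 + β * ‖e k‖ ^ 2 + γ * ‖w k‖ ^ 2 := by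
  open scoped Matrix.Norms.L2Operator in
  obtain ⟨a, hA⟩ := A.lipschitzWith_of_finiteDimensional
  obtain ⟨b, hB⟩ := B.lipschitzWith_of_finiteDimensional
  obtain ⟨hex, α, ν₂, ν₃, ν₄, hα, hν₂, hν₃, hν₄, hmain⟩ :=
    proposition2_general hA.lipschitzOnWith hB.lipschitzOnWith hQ hR hΘcompact hΘstab
  refine ⟨hex, α, ν₂, ν₃, ν₄, hα, hν₂, hν₃, hν₄, fun X μ hμ => ?_⟩
  obtain ⟨β, γ, hβ, hγ, hβeq, hdecrease⟩ := hmain X μ hμ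
  refine ⟨β, γ, hβ, hγ, hβeq, fun x w e u θ θhat _ hu he _ _ hθhat hx hstep k => ?_⟩
  exact hdecrease _ (hθhat k) _ (hθhat (k + 1)) _ _ _ _ (by rw [he, hu]; rfl) (hx (k + 1))
    (by rw [dist_eq_norm]; exact hstep k)
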